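/- Consider an initially empty $M_t/G/\infty$ queue: customers arrive at times $0<A_1\le A_2\le\dots$ (possibly only finitely many) forming a Poisson process on $(0,\infty)$ with non-negative, locally integrable rate function $\lambda:[0,\infty)\to[0,\infty)$ and counting process $N(t)=\#\{j: A_j\le t\}$, and customer $j$ stays for a service time $S_j\ge 0$, where $S_1,S_2,\dots$ are i.i.d. with distribution function $G$, and independent of the arrival times. Write $\overline G(x)=1-G(x)=P(S_1>x)$ and let $$Q^\infty(t)=\sum_{j=1}^{N(t)}\mathbf 1\{A_j<t<A_j+S_j\}$$ be the number of customers in the system at time $t$. Suppose that a further customer arrives at time $t\ge 0$, with a service time $\mathcal S$ that has distribution $G$ and is independent of $(A_j)_j$ and $(S_j)_j$. The number of customers this customer overlaps with is $$O(t)=N(t+\mathcal S)-N(t)+Q^\infty(t).$$ Then $O(t)$ has the mixed Poisson distribution with random mean $$\int_t^{t+\mathcal S}\lambda(s)\,ds+\int_0^t\lambda(u)\,\overline G(t-u)\,du ,$$ that is, its law is the mixture of the laws $\mathrm{Poisson}(m)$ where $m$ is distributed as this random variable. Moreover, with $\Lambda(t,s)=\int_t^{t+s}\lambda(u)\,du$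 and $q^\infty(t)=\int_0^t\lambda(u)\,\overline G(t-u)\,du$, which is the (finite) mean $E[Q^\infty(t)]$, one has for every integer $k\ge 0$ $$P(O(t)=k)=\int_{[0,\infty)} e^{-(\Lambda(t,s)+q^\infty(t))}\,\frac{(\Lambda(t,s)+q^\infty(t))^k}{k!}\,dG(s).$$ -/

import Mathlib

open MeasureTheory ProbabilityTheory
open scoped NNReal Nat

namespace InfiniteServer

variable {Ω : Type*}

/-- Number of arrivals up to and including time `t`, where `A j ω` is the arrival time of customer
`j` (customers are numbered from `0`); the value `⊤` means that there is no `j`-th arrival. -/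
noncomputable def arrivalCount (A : ℕ → Ω → EReal) (t : ℝ) (ω : Ω) : ℕ :=
  {j : ℕ | A j ω ≤ (t : EReal)}.ncard

/-- `A` lists in increasing order the arrival times of a (non-homogeneous) Poisson process on
`(0, ∞)` with rate function `lam`. -/
structure IsPoissonArrivals {mΩ : MeasurableSpace Ω} (A : ℕ → Ω → EReal) (lam : ℝ → ℝ)
    (P : Measure Ω) : Prop where
  measurable : ∀ j, Measurable (A j)
  monotone : ∀ᵐ ω ∂P, Monotone fun j => A j ω
  locallyFinite : ∀ᵐ ω ∂P, ∀ t : ℝ, {j : ℕ | A j ω ≤ (t : EReal)}.Finite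
  count_zero : ∀ᵐ ω ∂P, arrivalCount A 0 ω = 0
  indepIncrements :
    HasIndepIncrements (fun (t : ℝ≥0) ω => (arrivalCount A (t : ℝ) ω : ℝ)) P
  poisson_increments : ∀ s t : ℝ, 0 ≤ s → s ≤ t →
    HasLaw (fun ω => arrivalCount A t ω - arrivalCount A s ω)
      (poissonMeasure (∫ u in s..t, lam u).toNNReal) P

/-- The data of an initially empty `M_t/G/∞` queue together with a tagged customer: Poisson
arrivals with rate `lam`, i.i.d. service times `S j` with law `G`, and a service time `S₀` with
law `G` of the tagged customer; the arrival times, the service times of the other customers and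
`S₀` are independent. -/
structure IsMtGInfQueue {mΩ : MeasurableSpace Ω} (A : ℕ → Ω → EReal) (S : ℕ → Ω → ℝ)
    (S₀ : Ω → ℝ) (lam : ℝ → ℝ) (G : Measure ℝ) (P : Measure Ω) : Prop where
  arrivals : IsPoissonArrivals A lam P
  service_law : ∀ j, HasLaw (S j) G P
  service_indep : iIndepFun S P
  tagged_law : HasLaw S₀ G P
  indep_arrivals_service : IndepFun (fun ω j => A j ω) (fun ω j => S j ω) P
  indep_tagged : IndepFun (fun ω => ((fun j => A j ω), (fun j => S j ω))) S₀ P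

/-- Number of customers in the system at time `t`:
the sum of `1{A_j < t < A_j + S_j}` over the arrivals up to time `t`. -/
noncomputable def queueLength (A : ℕ → Ω → EReal) (S : ℕ → Ω → ℝ) (t : ℝ) (ω : Ω) : ℕ :=
  ∑ j ∈ Finset.range (arrivalCount A t ω),
    {ω' : Ω | A j ω' < (t : EReal) ∧ (t : EReal) < A j ω' + (S j ω' : EReal)}.indicator 1 ω

/-- Number of customers with whom a tagged customer, who arrives at time `t` and has service time
`S₀`, overlaps: the arrivals in `(t, t + S₀]` plus the customers present at time `t`. -/
noncomputable def overlapCount (A : ℕ → Ω → EReal) (S : ℕ → Ω → ℝ) (S₀ : Ω → ℝ) (t : ℝ)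
    (ω : Ω) : ℕ :=
  (arrivalCount A (t + S₀ ω) ω - arrivalCount A t ω) + queueLength A S t ω

/-- The integrated rate `Λ(t, s) = ∫_t^{t+s} λ(u) du`. -/
noncomputable def cumRate (lam : ℝ → ℝ) (t s : ℝ) : ℝ :=
  ∫ u in t..(t + s), lam u

/-- `q^∞(t) = ∫_0^t λ(u) P(S > t - u) du`, where the service time `S` has law `G`. -/
noncomputable def meanQueue (lam : ℝ → ℝ) (G : Measure ℝ) (t : ℝ) : ℝ :=
  ∫ u in (0 : ℝ)..t, lam u * G.real (Set.Ioi (t - u))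

theorem measurable_poissonMeasure : Measurable fun r : ℝ≥0 => poissonMeasure r := by
  refine Measure.measurable_of_measurable_coe _ fun s hs => ?_
  simp only [poissonMeasure, Measure.sum_apply _ hs, Measure.smul_apply, smul_eq_mul]
  fun_prop

/-- The law of a mixed Poisson variable with random mean `M`: the mixture of the Poisson laws
`Poisson(r)` where `r` is distributed as `M` (negative values of `M` are read as `0`). -/
noncomputable def mixedPoisson {mΩ : MeasurableSpace Ω} (M : Ω → ℝ) (P : Measure Ω) : Measure ℕ :=
  (P.map fun ω => (M ω).toNNReal).bind fun r => poissonMeasure r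

end InfiniteServer

namespace InfiniteServer

open Filter Topology

/-! Almost surely $O(t)$ is a single count: the customers $j$ with $A_j\le t+\mathcal S$ and
$t<A_j+S_j$. Arrivals in $(t,t+\mathcal S]$ satisfy the second condition automatically, since
$S_j\ge 0$; for earlier arrivals it says that the customer is still present. For fixed $\mathcal
S=s$ this is an independent thinning of the arrivals on $(0,t+s]$ that keeps a point at $u$ with
probability $\overline G(t-u)$. Hence it is Poisson with mean $\int_0^{t+s}\lambda(u)\overline
G(t-u)\,du=\Lambda(t,s)+q^\infty(t)$, because $\overline G(t-u)=1$ for $u>t$. Independence of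
$\mathcal S$ then gives the mixture (`hasLaw_overlapCount`).

Thinning is proved by transforms. Given the arrivals, the count has generating function $\prod_j
F(A_j)$ with $F(u)=1+(z-1)\overline G(t-u)$, and `IsPoissonArrivals.integral_prod` gives $E\prod_j
F(A_j)=\exp\int(F-1)\lambda$. For $F$ constant on grid cells this follows from independent Poisson
increments. The case at hand is a limit along finer grids, which needs only the left-continuity of
$F$. -/

/-! ### Measurability of counts, jointly in path and time because $t+\mathcal S$ is random -/

theorem measurable_arrivalCount :
    Measurable fun p : (ℕ → EReal) × ℝ => arrivalCount (fun j a => a j) p.2 p.1 := by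
  have hset : ∀ j : ℕ, MeasurableSet {p : (ℕ → EReal) × ℝ | p.1 j ≤ (p.2 : EReal)} := fun j =>
    measurableSet_le ((measurable_pi_apply j).comp measurable_fst)
      (measurable_coe_real_ereal.comp measurable_snd)
  have hpos : ∀ n : ℕ, n ≠ 0 → MeasurableSet
      ((fun p : (ℕ → EReal) × ℝ => arrivalCount (fun j a => a j) p.2 p.1) ⁻¹' {n}) := by
    intro n hn
    have : ((fun p : (ℕ → EReal) × ℝ => arrivalCount (fun j a => a j) p.2 p.1) ⁻¹' {n}) =
        ⋃ s : {s : Finset ℕ // s.card = n}, ⋂ j : ℕ,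
          {p : (ℕ → EReal) × ℝ | p.1 j ≤ (p.2 : EReal) ↔ j ∈ s.1} := by
      ext p
      simp only [Set.mem_preimage, Set.mem_singleton_iff, Set.mem_iUnion, Set.mem_iInter,
        Set.mem_ofPred_eq, arrivalCount]
      constructor
      · intro h
        have hfin : {j : ℕ | p.1 j ≤ (p.2 : EReal)}.Finite :=
          Set.finite_of_ncard_ne_zero (by rw [h]; exact hn)
        refine ⟨⟨hfin.toFinset, ?_⟩, fun j => by simp⟩
        rw [← Set.ncard_eq_toFinset_card _ hfin, h]
      · rintro ⟨⟨s, hs⟩, h⟩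
        have : {j : ℕ | p.1 j ≤ (p.2 : EReal)} = (s : Set ℕ) := by
          ext j; simpa using h j
        rw [this, Set.ncard_coe_finset, hs]
    rw [this]
    refine MeasurableSet.iUnion fun s => MeasurableSet.iInter fun j => ?_
    by_cases hj : j ∈ s.1
    · simpa [hj] using hset j
    · simp only [hj, iff_false]
      exact (hset j).compl
  refine measurable_to_countable' fun n => ?_
  -- `ncard` is also `0` on infinite sets, so the level set at `0` is obtained as the complement of
  -- all the others.
  rcases eq_or_ne n 0 with rfl | hn
  · have : ((fun p : (ℕ → EReal) × ℝ => arrivalCount (fun j a => a j) p.2 p.1) ⁻¹' {0}) =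
        (⋃ n : ℕ,
          (fun p : (ℕ → EReal) × ℝ => arrivalCount (fun j a => a j) p.2 p.1) ⁻¹' {n + 1})ᶜ := by
      ext p
      simp only [Set.mem_preimage, Set.mem_singleton_iff, Set.mem_compl_iff, Set.mem_iUnion]
      constructor
      · rintro h ⟨n, hn⟩
        omega
      · intro h
        by_contra h0
        exact h ⟨_, (Nat.succ_pred_eq_of_ne_zero h0).symm⟩
    rw [this]
    exact (MeasurableSet.iUnion fun n => hpos (n + 1) n.succ_ne_zero).compl
  · exact hpos n hn

theorem measurable_arrivalCount_apply (t : ℝ) :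
    Measurable fun a : ℕ → EReal => arrivalCount (fun j a => a j) t a :=
  measurable_arrivalCount.comp (measurable_id.prodMk measurable_const)

theorem measurable_prod_range {α M : Type*} [MeasurableSpace α] [MeasurableSpace M]
    [CommMonoid M] [MeasurableMul₂ M] {N : α → ℕ} (hN : Measurable N) {h : ℕ → α → M}
    (hh : ∀ j, Measurable (h j)) :
    Measurable fun x => ∏ j ∈ Finset.range (N x), h j x := by
  have : Measurable fun p : ℕ × α => ∏ j ∈ Finset.range p.1, h j p.2 :=
    measurable_from_prod_countable_right fun n =>
      Finset.measurable_fun_prod (Finset.range n) fun j _ => hh j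
  exact this.comp (hN.prodMk measurable_id)

theorem measurable_sum_range {α M : Type*} [MeasurableSpace α] [MeasurableSpace M]
    [AddCommMonoid M] [MeasurableAdd₂ M] {N : α → ℕ} (hN : Measurable N) {h : ℕ → α → M}
    (hh : ∀ j, Measurable (h j)) :
    Measurable fun x => ∑ j ∈ Finset.range (N x), h j x := by
  have : Measurable fun p : ℕ × α => ∑ j ∈ Finset.range p.1, h j p.2 :=
    measurable_from_prod_countable_right fun n =>
      Finset.measurable_fun_sum (Finset.range n) fun j _ => hh j
  exact this.comp (hN.prodMk measurable_id)

/-! ### Single paths: arrivals sorted into grid cells -/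

section Pathwise

variable {Ω : Type*} {A : ℕ → Ω → EReal} {ω : Ω}

theorem lt_arrivalCount_iff (hm : Monotone fun j => A j ω)
    (hf : ∀ t : ℝ, {j : ℕ | A j ω ≤ (t : EReal)}.Finite) (t : ℝ) (j : ℕ) :
    j < arrivalCount A t ω ↔ A j ω ≤ (t : EReal) := by
  have hcard : ∀ i, A i ω ≤ (t : EReal) → i < arrivalCount A t ω := by
    intro i hi
    have : (Finset.range (i + 1) : Set ℕ) ⊆ {j : ℕ | A j ω ≤ (t : EReal)} := by
      intro k hk
      have hk' : k ≤ i := by simpa [Nat.lt_succ_iff] using hk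
      exact (hm hk').trans hi
    have h := Set.ncard_le_ncard this (hf t)
    rw [Set.ncard_coe_finset, Finset.card_range] at h
    exact h
  refine ⟨fun h => ?_, hcard j⟩
  by_contra hj
  have : {j : ℕ | A j ω ≤ (t : EReal)} ⊆ (Finset.range j : Set ℕ) := by
    intro k hk
    by_contra hkj
    have hjk : j ≤ k := by simpa using hkj
    exact hj ((hm hjk).trans hk)
  have h' := Set.ncard_le_ncard this (Finset.finite_toSet _)
  rw [Set.ncard_coe_finset, Finset.card_range] at h'
  exact absurd h (not_lt.2 h')

theorem arrivalCount_mono (hf : ∀ t : ℝ, {j : ℕ | A j ω ≤ (t : EReal)}.Finite) :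
    Monotone fun t => arrivalCount A t ω := fun _ t hst =>
  Set.ncard_le_ncard (fun _ hj => le_trans hj (EReal.coe_le_coe_iff.2 hst)) (hf t)

theorem arrival_pos (hm : Monotone fun j => A j ω)
    (hf : ∀ t : ℝ, {j : ℕ | A j ω ≤ (t : EReal)}.Finite) (h0 : arrivalCount A 0 ω = 0) (j : ℕ) :
    0 < A j ω := by
  by_contra h
  have := (lt_arrivalCount_iff hm hf 0 j).2 (by simpa using h)
  omega

/-- The left endpoint of the interval `(i δ, (i + 1) δ]` that contains `u`. -/
noncomputable def gridLeft (δ u : ℝ) : ℝ := δ * ((⌈u / δ⌉ : ℝ) - 1)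

theorem gridLeft_eq {δ u : ℝ} (hδ : 0 < δ) {i : ℕ} (h1 : i * δ < u) (h2 : u ≤ (i + 1) * δ) :
    gridLeft δ u = i * δ := by
  have : ⌈u / δ⌉ = (i : ℤ) + 1 := by
    rw [Int.ceil_eq_iff]
    push_cast
    constructor
    · rw [lt_div_iff₀ hδ]; linarith
    · rw [div_le_iff₀ hδ]; exact h2
  rw [gridLeft, this]; push_cast; ring

theorem gridLeft_lt {δ : ℝ} (hδ : 0 < δ) (u : ℝ) : gridLeft δ u < u := by
  have h := Int.ceil_lt_add_one (u / δ)
  have : (⌈u / δ⌉ : ℝ) - 1 < u / δ := by linarith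
  calc gridLeft δ u < δ * (u / δ) := mul_lt_mul_of_pos_left this hδ
    _ = u := by field_simp

theorem le_gridLeft {δ : ℝ} (hδ : 0 < δ) (u : ℝ) : u - δ ≤ gridLeft δ u := by
  have h := Int.le_ceil (u / δ)
  calc u - δ = δ * (u / δ - 1) := by field_simp
    _ ≤ _ := mul_le_mul_of_nonneg_left (by linarith) hδ.le

theorem measurable_gridLeft (δ : ℝ) : Measurable (gridLeft δ) := by
  unfold gridLeft
  have : Measurable fun u : ℝ => (⌈u / δ⌉ : ℝ) :=
    measurable_from_top.comp (Int.measurable_ceil.comp (measurable_id.div_const δ))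
  exact (this.sub_const 1).const_mul δ

/-- The labels of the arrivals in one cell form an interval of integers, and all of them contribute
the value of `F` at the left endpoint. This turns a product over points into a product over
increments. -/
theorem prod_gridLeft_eq (hm : Monotone fun j => A j ω)
    (hf : ∀ t : ℝ, {j : ℕ | A j ω ≤ (t : EReal)}.Finite) (h0 : arrivalCount A 0 ω = 0)
    {M : Type*} [CommMonoid M] (F : ℝ → M) {δ : ℝ} (hδ : 0 < δ) (n : ℕ) :
    ∏ j ∈ Finset.range (arrivalCount A (n * δ) ω), F (gridLeft δ (A j ω).toReal) =
      ∏ i ∈ Finset.range n,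
        F (i * δ) ^ (arrivalCount A ((i + 1 : ℕ) * δ) ω - arrivalCount A (i * δ) ω) := by
  induction n with
  | zero => simp [h0]
  | succ n ih =>
    have hle : arrivalCount A (n * δ) ω ≤ arrivalCount A ((n + 1 : ℕ) * δ) ω :=
      arrivalCount_mono hf (by push_cast; nlinarith)
    rw [Finset.prod_range_succ, ← ih, ← Finset.prod_range_mul_prod_Ico _ hle]
    congr 1
    rw [Finset.prod_congr rfl (g := fun _ => F (n * δ)), Finset.prod_const, Nat.card_Ico]
    intro j hj
    rw [Finset.mem_Ico] at hj
    have h1 : ((n * δ : ℝ) : EReal) < A j ω := by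
      by_contra h
      exact absurd ((lt_arrivalCount_iff hm hf _ j).2 (not_lt.1 h)) (not_lt.2 hj.1)
    have h2 := (lt_arrivalCount_iff hm hf _ j).1 hj.2
    have hc : ((A j ω).toReal : EReal) = A j ω :=
      EReal.coe_toReal (ne_top_of_le_ne_top (EReal.coe_ne_top _) h2)
        (ne_bot_of_gt h1)
    rw [← hc, EReal.coe_lt_coe_iff] at h1
    rw [← hc, EReal.coe_le_coe_iff] at h2
    rw [gridLeft_eq hδ h1 (by push_cast at h2; exact h2)]

end Pathwise

theorem integral_pow_poissonMeasure (r : ℝ≥0) (z : ℂ) :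
    ∫ n, z ^ n ∂(poissonMeasure r) = Complex.exp (r * (z - 1)) := by
  rw [integral_poissonMeasure]
  calc ∑' n : ℕ, (Real.exp (-r) * r ^ n / n !) • z ^ n
      = ∑' n : ℕ, (Real.exp (-r) : ℂ) * ((r * z) ^ n / n !) := by
        congr with n
        rw [Complex.real_smul]
        push_cast
        rw [mul_pow]
        ring
    _ = (Real.exp (-r) : ℂ) * Complex.exp (r * z) := by
        rw [tsum_mul_left, (NormedSpace.expSeries_div_hasSum_exp ((r : ℂ) * z)).tsum_eq,
          Complex.exp_eq_exp_ℂ]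
    _ = _ := by
        rw [Complex.ofReal_exp, ← Complex.exp_add]
        push_cast
        ring_nf

/-! ### Generating functional of the arrival process -/

section Functional

variable {Ω : Type*} {mΩ : MeasurableSpace Ω} {P : Measure Ω}
  {lam : ℝ → ℝ} {A : ℕ → Ω → EReal}

theorem IsPoissonArrivals.measurable_count (hA : IsPoissonArrivals A lam P) (t : ℝ) :
    Measurable (arrivalCount A t) :=
  (measurable_arrivalCount_apply t).comp (measurable_pi_lambda _ hA.measurable)

theorem intervalIntegrable_of_locallyIntegrableOn_Ici
    (hlam_int : LocallyIntegrableOn lam (Set.Ici 0)) {s t : ℝ} (hs : 0 ≤ s) (ht : 0 ≤ t) :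
    IntervalIntegrable lam volume s t := by
  rw [intervalIntegrable_iff]
  refine (hlam_int.integrableOn_compact_subset (t := Set.uIcc s t) ?_ isCompact_uIcc).mono_set
    Set.uIoc_subset_uIcc
  intro x hx
  exact le_trans (le_min hs ht) hx.1

/-- By independence the expectation factors over the cells; each factor is a Poisson generating
function $\exp(m_i(F(i\delta)-1))$ with $m_i$ the integral of the rate over the cell, and the
exponents add up to one integral. -/
theorem IsPoissonArrivals.integral_prod_gridLeft [IsProbabilityMeasure P]
    (hA : IsPoissonArrivals A lam P)
    (hlam_nonneg : ∀ u, 0 ≤ u → 0 ≤ lam u) (hlam_int : LocallyIntegrableOn lam (Set.Ici 0))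
    (F : ℝ → ℂ) {δ : ℝ} (hδ : 0 < δ) (n : ℕ) :
    ∫ ω, ∏ j ∈ Finset.range (arrivalCount A (n * δ) ω), F (gridLeft δ (A j ω).toReal) ∂P =
      Complex.exp (∫ u in (0 : ℝ)..(n * δ), (F (gridLeft δ u) - 1) * lam u) := by
  have hint : ∀ i : ℕ, IntervalIntegrable lam volume (i * δ) ((i + 1 : ℕ) * δ) := fun i =>
    intervalIntegrable_of_locallyIntegrableOn_Ici hlam_int (by positivity) (by positivity)
  have hle : ∀ i : ℕ, (i * δ : ℝ) ≤ (i + 1 : ℕ) * δ := fun i => by push_cast; nlinarith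
  have hstep : ∀ i : ℕ, Set.EqOn (fun u => (F (gridLeft δ u) - 1) * lam u)
      (fun u => (F (i * δ) - 1) * lam u) (Set.uIoc (i * δ) ((i + 1 : ℕ) * δ)) := by
    intro i u hu
    rw [Set.uIoc_of_le (hle i)] at hu
    have h2 := hu.2
    push_cast at h2
    simp only [gridLeft_eq hδ hu.1 h2]
  have hint' : ∀ i : ℕ, IntervalIntegrable (fun u => (F (gridLeft δ u) - 1) * (lam u : ℂ)) volume
      (i * δ) ((i + 1 : ℕ) * δ) := fun i =>
    (intervalIntegrable_congr (hstep i)).2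
      (IntervalIntegrable.const_mul ⟨(hint i).1.ofReal, (hint i).2.ofReal⟩ _)
  have hsum := intervalIntegral.sum_integral_adjacent_intervals (n := n)
    (a := fun i : ℕ => (i : ℝ) * δ) (fun i _ => hint' i)
  simp only [Nat.cast_zero, zero_mul] at hsum
  rw [← hsum, Complex.exp_sum]
  -- Independence of increments is available for the real-valued process, so the exponent is written
  -- as the floor of a real difference; by monotonicity this is the natural-number increment.
  have hpath : ∀ᵐ ω ∂P,
      ∏ j ∈ Finset.range (arrivalCount A (n * δ) ω), F (gridLeft δ (A j ω).toReal) =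
      ∏ i : Fin n, F ((i : ℕ) * δ) ^
        ⌊(arrivalCount A (((i : ℕ) + 1 : ℕ) * δ) ω : ℝ) - arrivalCount A ((i : ℕ) * δ) ω⌋₊ := by
    filter_upwards [hA.monotone, hA.locallyFinite, hA.count_zero] with ω hm hf h0
    rw [prod_gridLeft_eq hm hf h0 F hδ n, Finset.prod_range]
    refine Finset.prod_congr rfl fun i _ => ?_
    rw [← Nat.cast_sub (arrivalCount_mono hf (hle i)), Nat.floor_natCast]
  rw [integral_congr_ae hpath]
  have hind := (hasIndepIncrements_iff_nat.1 hA.indepIncrements)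
    (fun i : ℕ => (i : ℝ≥0) * δ.toNNReal) (fun i j hij =>
      mul_le_mul_of_nonneg_right (by exact_mod_cast hij) zero_le)
  simp only [NNReal.coe_mul, NNReal.coe_natCast, Real.coe_toNNReal _ hδ.le] at hind
  have hind' := hind.precomp (g := fun i : Fin n => (i : ℕ)) Fin.val_injective
  have hprod := hind'.integral_fun_prod_comp (𝕜 := ℂ)
    (f := fun (i : Fin n) (x : ℝ) => F ((i : ℕ) * δ) ^ ⌊x⌋₊)
    (fun i => Measurable.aemeasurable <|
      ((measurable_from_top (f := Nat.cast)).comp (hA.measurable_count _)).sub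
        ((measurable_from_top (f := Nat.cast)).comp (hA.measurable_count _)))
    (fun i => (measurable_from_top.comp Nat.measurable_floor).aestronglyMeasurable)
  rw [hprod, Finset.prod_range]
  refine Finset.prod_congr rfl fun i _ => ?_
  have hlaw := hA.poisson_increments (i * δ) ((i + 1 : ℕ) * δ) (by positivity) (hle i)
  have hi : ∀ᵐ ω ∂P, F ((i : ℕ) * δ) ^
        ⌊(arrivalCount A (((i : ℕ) + 1 : ℕ) * δ) ω : ℝ) - arrivalCount A ((i : ℕ) * δ) ω⌋₊ =
      F ((i : ℕ) * δ) ^ (arrivalCount A (((i : ℕ) + 1 : ℕ) * δ) ω -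
        arrivalCount A ((i : ℕ) * δ) ω) := by
    filter_upwards [hA.locallyFinite] with ω hf
    rw [← Nat.cast_sub (arrivalCount_mono hf (hle i)), Nat.floor_natCast]
  rw [integral_congr_ae hi]
  have := hlaw.integral_comp (f := fun k => F ((i : ℕ) * δ) ^ k)
    measurable_from_top.aestronglyMeasurable
  simp only [Function.comp_def] at this
  rw [this, integral_pow_poissonMeasure, intervalIntegral.integral_congr_ae
      (ae_of_all _ fun u hu => hstep i hu),
    intervalIntegral.integral_const_mul, intervalIntegral.integral_ofReal]
  rw [show (((∫ u in (i * δ : ℝ)..(i + 1 : ℕ) * δ, lam u).toNNReal : ℝ≥0) : ℂ) =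
    ((∫ u in (i * δ : ℝ)..(i + 1 : ℕ) * δ, lam u : ℝ) : ℂ) from ?_, mul_comm]
  have hnn : 0 ≤ ∫ u in (i * δ : ℝ)..(i + 1 : ℕ) * δ, lam u :=
    intervalIntegral.integral_nonneg (hle i) fun u hu =>
      hlam_nonneg u (le_trans (by positivity) hu.1)
  exact congrArg Complex.ofReal (Real.coe_toNNReal _ hnn)

end Functional
theorem tendsto_gridLeft {δ : ℕ → ℝ} (hδ : ∀ n, 0 < δ n) (hδ0 : Tendsto δ atTop (𝓝 0)) (u : ℝ) :
    Tendsto (fun n => gridLeft (δ n) u) atTop (𝓝[≤] u) := by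
  refine tendsto_nhdsWithin_iff.2 ⟨?_, Eventually.of_forall fun n => (gridLeft_lt (hδ n) u).le⟩
  have h : Tendsto (fun n => u - δ n) atTop (𝓝 u) := by
    simpa using tendsto_const_nhds.sub hδ0
  exact tendsto_of_tendsto_of_tendsto_of_le_of_le h tendsto_const_nhds
    (fun n => le_gridLeft (hδ n) u) (fun n => (gridLeft_lt (hδ n) u).le)

section Functional

variable {Ω : Type*} {mΩ : MeasurableSpace Ω} {P : Measure Ω}
  {lam : ℝ → ℝ} {A : ℕ → Ω → EReal}

/-- The generating functional of a Poisson process. -/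
theorem IsPoissonArrivals.integral_prod [IsProbabilityMeasure P] (hA : IsPoissonArrivals A lam P)
    (hlam_nonneg : ∀ u, 0 ≤ u → 0 ≤ lam u) (hlam_int : LocallyIntegrableOn lam (Set.Ici 0))
    {F : ℝ → ℂ} (hF : Measurable F) (hF1 : ∀ u, ‖F u‖ ≤ 1)
    (hFl : ∀ u, ContinuousWithinAt F (Set.Iic u) u) {T : ℝ} (hT : 0 ≤ T) :
    ∫ ω, ∏ j ∈ Finset.range (arrivalCount A T ω), F (A j ω).toReal ∂P =
      Complex.exp (∫ u in (0 : ℝ)..T, (F u - 1) * lam u) := by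
  rcases hT.eq_or_lt with rfl | hT
  · have : ∀ᵐ ω ∂P, ∏ j ∈ Finset.range (arrivalCount A 0 ω), F (A j ω).toReal = 1 := by
      filter_upwards [hA.count_zero] with ω h0
      simp [h0]
    rw [integral_congr_ae this]
    simp
  -- This mesh makes $T$ the grid point of index $n+1$, so no partial cell is left over.
  set δ : ℕ → ℝ := fun n => T / ((n : ℝ) + 1) with hδdef
  have hδ : ∀ n, 0 < δ n := fun n => by positivity
  have hδ0 : Tendsto δ atTop (𝓝 0) := by
    simpa [hδdef, div_eq_mul_inv] using
      (tendsto_one_div_add_atTop_nhds_zero_nat (𝕜 := ℝ)).const_mul T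
  have hnδ : ∀ n, ((n + 1 : ℕ) : ℝ) * δ n = T := fun n => by
    simp only [hδdef]; push_cast; field_simp
  have hlim : ∀ u, Tendsto (fun n => F (gridLeft (δ n) u)) atTop (𝓝 (F u)) := fun u =>
    (hFl u).tendsto.comp (tendsto_gridLeft hδ hδ0 u)
  have key : ∀ n, ∫ ω, ∏ j ∈ Finset.range (arrivalCount A T ω),
        F (gridLeft (δ n) (A j ω).toReal) ∂P =
      Complex.exp (∫ u in (0 : ℝ)..T, (F (gridLeft (δ n) u) - 1) * lam u) := by
    intro n
    have := hA.integral_prod_gridLeft hlam_nonneg hlam_int F (hδ n) (n + 1)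
    rwa [hnδ n] at this
  have hleft : Tendsto (fun n => ∫ ω, ∏ j ∈ Finset.range (arrivalCount A T ω),
        F (gridLeft (δ n) (A j ω).toReal) ∂P) atTop
      (𝓝 (∫ ω, ∏ j ∈ Finset.range (arrivalCount A T ω), F (A j ω).toReal ∂P)) := by
    -- For each `ω` the product has finitely many factors, each of norm at most `1`, so pointwise
    -- convergence of the factors suffices.
    refine tendsto_integral_of_dominated_convergence (fun _ => 1) (fun n => ?_)
      (integrable_const _) (fun n => ae_of_all _ fun ω => ?_) (ae_of_all _ fun ω => ?_)
    · exact (measurable_prod_range (hA.measurable_count T) fun j =>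
        hF.comp ((measurable_gridLeft _).comp
          (measurable_ereal_toReal.comp (hA.measurable j)))).aestronglyMeasurable
    · rw [norm_prod]
      exact Finset.prod_le_one (fun _ _ => norm_nonneg _) fun _ _ => hF1 _
    · exact tendsto_finsetProd _ fun j _ => hlim _
  have hlamT := intervalIntegrable_of_locallyIntegrableOn_Ici hlam_int le_rfl hT.le
  have hright : Tendsto (fun n => ∫ u in (0 : ℝ)..T, (F (gridLeft (δ n) u) - 1) * lam u) atTop
      (𝓝 (∫ u in (0 : ℝ)..T, (F u - 1) * lam u)) := by
    refine intervalIntegral.tendsto_integral_filter_of_dominated_convergence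
      (fun u => 2 * ‖lam u‖) (Eventually.of_forall fun n => ?_)
      (Eventually.of_forall fun n => ae_of_all _ fun u _ => ?_) (hlamT.norm.const_mul 2)
      (ae_of_all _ fun u _ => ((hlim u).sub_const 1).mul_const _)
    · exact ((hF.comp (measurable_gridLeft _)).sub_const 1).aestronglyMeasurable.mul
        (Complex.continuous_ofReal.comp_aestronglyMeasurable
          hlamT.def'.aestronglyMeasurable)
    · rw [norm_mul, Complex.norm_real]
      refine mul_le_mul_of_nonneg_right ((norm_sub_le _ _).trans ?_) (norm_nonneg _)
      rw [norm_one]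
      linarith [hF1 (gridLeft (δ n) u)]
  refine tendsto_nhds_unique hleft ?_
  simp only [key]
  exact (Complex.continuous_exp.tendsto _).comp hright

/-- An arrival at $t>0$ forces a nonzero increment over $(s_n,t]$, which has probability
$1-\exp(-\int_{s_n}^t\lambda)\to 0$ as $s_n\uparrow t$. This reconciles the strict inequality
$A_j<t$ in `queueLength` with $A_j\le t$ in `presentCount`. -/
theorem IsPoissonArrivals.ae_ne [IsProbabilityMeasure P] (hA : IsPoissonArrivals A lam P)
    (hlam_int : LocallyIntegrableOn lam (Set.Ici 0)) {t : ℝ} (ht : 0 ≤ t) :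
    ∀ᵐ ω ∂P, ∀ j, A j ω ≠ (t : EReal) := by
  rcases ht.eq_or_lt with rfl | ht
  · filter_upwards [hA.monotone, hA.locallyFinite, hA.count_zero] with ω hm hf h0 j
    exact (arrival_pos hm hf h0 j).ne'
  set s : ℕ → ℝ := fun n => t - t / ((n : ℝ) + 1) with hsdef
  have hst : ∀ n, s n < t := fun n => by
    have : 0 < t / ((n : ℝ) + 1) := by positivity
    simp only [hsdef]; linarith
  have hs0 : ∀ n, 0 ≤ s n := fun n => by
    have : t / ((n : ℝ) + 1) ≤ t := div_le_self ht.le (by linarith [n.cast_nonneg (α := ℝ)])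
    simp only [hsdef]; linarith
  have hs : Tendsto s atTop (𝓝 t) := by
    simpa [hsdef, div_eq_mul_inv] using
      ((tendsto_one_div_add_atTop_nhds_zero_nat (𝕜 := ℝ)).const_mul t).const_sub t
  have hlamT := intervalIntegrable_of_locallyIntegrableOn_Ici hlam_int le_rfl ht.le
  have hI : Tendsto (fun n => ∫ u in s n..t, lam u) atTop (𝓝 0) := by
    have hc := intervalIntegral.continuousOn_primitive_interval' hlamT
      (Set.right_mem_uIcc)
    have := (hc t Set.right_mem_uIcc).tendsto.comp (tendsto_nhdsWithin_iff.2
      ⟨hs, Eventually.of_forall fun n => by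
        rw [Set.uIcc_of_le ht.le]; exact ⟨hs0 n, (hst n).le⟩⟩)
    simp only [intervalIntegral.integral_same] at this
    have := this.neg
    rw [neg_zero] at this
    refine this.congr fun n => ?_
    rw [Function.comp_apply, intervalIntegral.integral_symm, neg_neg]
  have hE : ∀ n, P.real {ω | ∃ j, A j ω = (t : EReal)} ≤
      1 - Real.exp (-((∫ u in s n..t, lam u).toNNReal : ℝ)) := by
    intro n
    have hlaw := hA.poisson_increments (s n) t (hs0 n) (hst n).le
    have h1 := hlaw.measureReal_eq (p := fun k => k = 0) (Set.to_countable _).measurableSet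
    have h2 : (poissonMeasure (∫ u in s n..t, lam u).toNNReal).real {k | k = 0} =
        Real.exp (-((∫ u in s n..t, lam u).toNNReal : ℝ)) := by
      have := poissonMeasure_real_singleton (∫ u in s n..t, lam u).toNNReal 0
      simpa using this
    have hmeas : MeasurableSet {ω | arrivalCount A t ω - arrivalCount A (s n) ω = 0} :=
      ((hA.measurable_count t).sub (hA.measurable_count (s n))) (MeasurableSet.singleton 0)
    rw [← h2, ← h1, ← probReal_compl_eq_one_sub hmeas]
    refine ENNReal.toReal_mono (measure_ne_top _ _) (measure_mono_ae ?_)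
    filter_upwards [hA.monotone, hA.locallyFinite] with ω hm hf
    rintro ⟨j, hj⟩
    have ha := (lt_arrivalCount_iff hm hf t j).2 hj.le
    have hb : ¬ j < arrivalCount A (s n) ω := by
      rw [lt_arrivalCount_iff hm hf, hj, EReal.coe_le_coe_iff]
      exact not_le.2 (hst n)
    change ¬ (arrivalCount A t ω - arrivalCount A (s n) ω = 0)
    omega
  have hlim : Tendsto (fun n => 1 - Real.exp (-((∫ u in s n..t, lam u).toNNReal : ℝ))) atTop
      (𝓝 0) := by
    have : Tendsto (fun n => ((∫ u in s n..t, lam u).toNNReal : ℝ)) atTop (𝓝 0) := by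
      simpa only [Function.comp_def, Real.toNNReal_zero, NNReal.coe_zero] using
        (NNReal.continuous_coe.tendsto _).comp ((continuous_real_toNNReal.tendsto _).comp hI)
    simpa using ((Real.continuous_exp.tendsto _).comp this.neg).const_sub 1
  have hzero : P.real {ω | ∃ j, A j ω = (t : EReal)} = 0 :=
    le_antisymm (ge_of_tendsto' hlim hE) measureReal_nonneg
  rw [measureReal_eq_zero_iff] at hzero
  rw [ae_iff]
  simpa using hzero

end Functional

/-! ### The thinned count and the service-time tail -/

/-- The number of customers among the arrivals up to time `T` whose departure is after `t`. -/
noncomputable def presentCount (t T : ℝ) (p : (ℕ → EReal) × (ℕ → ℝ)) : ℕ :=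
  ∑ j ∈ Finset.range (arrivalCount (fun j a => a j) T p.1),
    if t < (p.1 j).toReal + p.2 j then 1 else 0

theorem presentCount_apply (t T : ℝ) (a : ℕ → EReal) (σ : ℕ → ℝ) :
    presentCount t T (a, σ) = ∑ j ∈ Finset.range (arrivalCount (fun j a => a j) T a),
      if t < (a j).toReal + σ j then 1 else 0 := rfl

theorem measurable_presentCount_uncurry (t : ℝ) {T : ℝ → ℝ} (hT : Measurable T) :
    Measurable fun q : ((ℕ → EReal) × (ℕ → ℝ)) × ℝ => presentCount t (T q.2) q.1 := by
  have hN : Measurable fun q : ((ℕ → EReal) × (ℕ → ℝ)) × ℝ =>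
      arrivalCount (fun j a => a j) (T q.2) q.1.1 :=
    measurable_arrivalCount.comp (measurable_fst.fst.prodMk (hT.comp measurable_snd))
  have hh : ∀ j : ℕ, Measurable fun q : ((ℕ → EReal) × (ℕ → ℝ)) × ℝ =>
      if t < (q.1.1 j).toReal + q.1.2 j then 1 else 0 := by
    intro j
    have h1 : Measurable fun q : ((ℕ → EReal) × (ℕ → ℝ)) × ℝ => (q.1.1 j).toReal :=
      measurable_ereal_toReal.comp ((measurable_pi_apply j).comp measurable_fst.fst)
    have h2 : Measurable fun q : ((ℕ → EReal) × (ℕ → ℝ)) × ℝ => q.1.2 j :=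
      (measurable_pi_apply j).comp measurable_fst.snd
    exact Measurable.ite (measurableSet_lt measurable_const (h1.add h2))
      measurable_const measurable_const
  exact measurable_sum_range (M := ℕ) hN hh

attribute [irreducible] presentCount

theorem measurable_presentCount (t T : ℝ) : Measurable (presentCount t T) :=
  Measurable.of_uncurry_right (f := fun p s => presentCount t s p)
    (measurable_presentCount_uncurry t measurable_id) (y := T)

section Tail

variable (G : Measure ℝ) [IsProbabilityMeasure G] (t : ℝ)

theorem monotone_tail : Monotone fun u => G.real (Set.Ioi (t - u)) := fun u v huv =>
  measureReal_mono (Set.Ioi_subset_Ioi (by linarith))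

/-- The reflection $u\mapsto t-u$ turns right-continuity of the distribution function into
left-continuity; hence the choice of left endpoints in `gridLeft`. -/
theorem continuousWithinAt_tail (u : ℝ) :
    ContinuousWithinAt (fun u => G.real (Set.Ioi (t - u))) (Set.Iic u) u := by
  have h : ∀ v, G.real (Set.Ioi (t - v)) = 1 - cdf G (t - v) := fun v => by
    rw [cdf_eq_real, ← probReal_compl_eq_one_sub measurableSet_Iic, Set.compl_Iic]
  simp only [h]
  refine continuousWithinAt_const.sub ?_
  exact ((cdf G).right_continuous (t - u)).comp
    (continuous_const.sub continuous_id).continuousWithinAt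
    (fun v hv => by
      have : v ≤ u := hv
      simp only [Set.mem_Ici]
      linarith)

theorem integral_pow_ite (z : ℂ) (u : ℝ) :
    ∫ x, z ^ (if t < u + x then 1 else 0) ∂G = 1 + (z - 1) * G.real (Set.Ioi (t - u)) := by
  have : (fun x => z ^ (if t < u + x then 1 else 0)) =
      fun x => 1 + (Set.Ioi (t - u)).indicator (fun _ => z - 1) x := by
    ext x
    by_cases hx : t < u + x
    · have : x ∈ Set.Ioi (t - u) := by simp only [Set.mem_Ioi]; linarith
      simp [hx, Set.indicator_of_mem this]
    · have : x ∉ Set.Ioi (t - u) := by simp only [Set.mem_Ioi]; linarith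
      simp [hx, Set.indicator_of_notMem this]
  rw [this, integral_add (integrable_const _)
    ((integrable_const _).indicator measurableSet_Ioi), integral_indicator measurableSet_Ioi]
  simp [mul_comm]

end Tail

/-! ### Mean of the Poisson law -/

theorem hasSum_mean_poissonMeasure (r : ℝ≥0) :
    HasSum (fun n : ℕ => Real.exp (-r) * r ^ n / n ! * (n : ℝ)) r := by
  rw [← hasSum_nat_add_iff' 1]
  have h := (hasSum_one_poissonMeasure r).mul_left (r : ℝ)
  simp only [mul_one, Finset.range_one, Finset.sum_singleton, Nat.cast_zero, mul_zero, sub_zero]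
    at h ⊢
  refine h.congr_fun fun n => ?_
  rw [Nat.factorial_succ]
  push_cast
  field_simp
  ring

theorem integrable_natCast_poissonMeasure (r : ℝ≥0) :
    Integrable (fun n : ℕ => (n : ℝ)) (poissonMeasure r) := by
  rw [integrable_poissonMeasure_iff]
  simpa using (hasSum_mean_poissonMeasure r).summable

theorem integral_natCast_poissonMeasure (r : ℝ≥0) :
    ∫ n : ℕ, (n : ℝ) ∂(poissonMeasure r) = r := by
  rw [integral_poissonMeasure]
  simpa using (hasSum_mean_poissonMeasure r).tsum_eq

/-! ### Thinning, and the law of the overlap count -/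

section Queue

variable {Ω : Type*} {mΩ : MeasurableSpace Ω} {P : Measure Ω}
  {lam : ℝ → ℝ} {G : Measure ℝ}
  {A : ℕ → Ω → EReal} {S : ℕ → Ω → ℝ} {S₀ : Ω → ℝ}

theorem intervalIntegrable_mul_tail [IsProbabilityMeasure G]
    (hlam_int : LocallyIntegrableOn lam (Set.Ici 0))
    (t : ℝ) {a b : ℝ} (ha : 0 ≤ a) (hb : 0 ≤ b) :
    IntervalIntegrable (fun u => lam u * G.real (Set.Ioi (t - u))) volume a b := by
  have h := intervalIntegrable_of_locallyIntegrableOn_Ici hlam_int ha hb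
  rw [intervalIntegrable_iff] at h ⊢
  refine h.mul_bdd (c := 1) (monotone_tail G t).measurable.aestronglyMeasurable
    (ae_of_all _ fun u => ?_)
  rw [Real.norm_of_nonneg measureReal_nonneg]
  exact measureReal_le_one

theorem integral_mul_tail_nonneg (hlam_nonneg : ∀ u, 0 ≤ u → 0 ≤ lam u) (t : ℝ) {T : ℝ}
    (hT : 0 ≤ T) : 0 ≤ ∫ u in (0 : ℝ)..T, lam u * G.real (Set.Ioi (t - u)) :=
  intervalIntegral.integral_nonneg hT fun u hu => mul_nonneg (hlam_nonneg u hu.1) measureReal_nonneg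

/-- Past $t$ the threshold $t-u$ is negative, so the tail there is the full mass of $[0,\infty)$. -/
theorem integral_mul_tail_eq [IsProbabilityMeasure G]
    (hlam_int : LocallyIntegrableOn lam (Set.Ici 0))
    (hG : G (Set.Iio 0) = 0) {t s : ℝ} (ht : 0 ≤ t) (hs : 0 ≤ s) :
    ∫ u in (0 : ℝ)..(t + s), lam u * G.real (Set.Ioi (t - u)) =
      cumRate lam t s + meanQueue lam G t := by
  rw [cumRate, meanQueue, add_comm (∫ _ in t.._, _),
    ← intervalIntegral.integral_add_adjacent_intervals
    (intervalIntegrable_mul_tail hlam_int t le_rfl ht)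
    (intervalIntegrable_mul_tail hlam_int t ht (add_nonneg ht hs))]
  congr 1
  refine intervalIntegral.integral_congr_ae (ae_of_all _ fun u hu => ?_)
  rw [Set.uIoc_of_le (by linarith)] at hu
  have h1 : G.real (Set.Ici 0) = 1 := by
    rw [← Set.compl_Iio, probReal_compl_eq_one_sub measurableSet_Iio, measureReal_def, hG]
    simp
  have h2 : G.real (Set.Ici 0) ≤ G.real (Set.Ioi (t - u)) :=
    measureReal_mono fun x hx => lt_of_lt_of_le (by linarith [hu.1] : t - u < 0) hx
  rw [le_antisymm measureReal_le_one (h1 ▸ h2), mul_one]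

theorem IsMtGInfQueue.aemeasurable_data (hQ : IsMtGInfQueue A S S₀ lam G P) :
    AEMeasurable (fun ω => ((fun j => A j ω), (fun j => S j ω))) P :=
  (measurable_pi_lambda _ hQ.arrivals.measurable).aemeasurable.prodMk
    (aemeasurable_pi_lambda _ fun j => (hQ.service_law j).aemeasurable)

theorem IsMtGInfQueue.integral_pow_service [IsProbabilityMeasure G]
    (hQ : IsMtGInfQueue A S S₀ lam G P) (t : ℝ) (z : ℂ)
    (n : ℕ) (a : ℕ → ℝ) :
    ∫ ω, z ^ (∑ j ∈ Finset.range n, if t < a j + S j ω then 1 else 0) ∂P =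
      ∏ j ∈ Finset.range n, (1 + (z - 1) * (G.real (Set.Ioi (t - a j)) : ℂ)) := by
  have hmeas : ∀ j : ℕ, Measurable fun x : ℝ => z ^ (if t < a j + x then 1 else 0) := fun j =>
    (measurable_from_top (f := fun k : ℕ => z ^ k)).comp
      (Measurable.ite (measurableSet_lt measurable_const (measurable_id.const_add _))
        measurable_const measurable_const)
  have h := (hQ.service_indep.precomp (g := fun i : Fin n => (i : ℕ))
    Fin.val_injective).integral_fun_prod_comp (𝕜 := ℂ)
    (f := fun (i : Fin n) (x : ℝ) => z ^ (if t < a i + x then 1 else 0))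
    (fun i => (hQ.service_law i).aemeasurable) (fun i => (hmeas i).aestronglyMeasurable)
  simp only [← Finset.prod_pow_eq_pow_sum, Finset.prod_range]
  rw [h]
  refine Finset.prod_congr rfl fun i _ => ?_
  have := (hQ.service_law i).integral_comp (hmeas i).aestronglyMeasurable
  simp only [Function.comp_def] at this
  rw [this, integral_pow_ite]

/-- The service times are integrated out first with the arrivals frozen (Fubini, by independence);
the remaining product over arrivals is an instance of the generating functional. -/
theorem IsMtGInfQueue.integral_pow_presentCount [IsProbabilityMeasure P]
    [IsProbabilityMeasure G] (hQ : IsMtGInfQueue A S S₀ lam G P)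
    (hlam_nonneg : ∀ u, 0 ≤ u → 0 ≤ lam u) (hlam_int : LocallyIntegrableOn lam (Set.Ici 0))
    (t : ℝ) {T : ℝ} (hT : 0 ≤ T) {z : ℂ} (hz : ‖z‖ ≤ 1) :
    ∫ ω, z ^ presentCount t T ((fun j => A j ω), (fun j => S j ω)) ∂P =
      Complex.exp ((∫ u in (0 : ℝ)..T, lam u * G.real (Set.Ioi (t - u)) : ℝ) * (z - 1)) := by
  have hA : Measurable fun ω => (fun j => A j ω) := measurable_pi_lambda _ hQ.arrivals.measurable
  have hS : AEMeasurable (fun ω => (fun j => S j ω)) P :=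
    aemeasurable_pi_lambda _ fun j => (hQ.service_law j).aemeasurable
  have := Measure.isProbabilityMeasure_map (μ := P) hA.aemeasurable
  have := Measure.isProbabilityMeasure_map hS
  have hz' : Measurable fun p => z ^ presentCount t T p :=
    (measurable_from_top (f := fun k : ℕ => z ^ k)).comp (measurable_presentCount t T)
  set g : ℝ → ℝ := fun u => G.real (Set.Ioi (t - u)) with hg
  set F : ℝ → ℂ := fun u => 1 + (z - 1) * (g u : ℂ) with hF
  have hFmeas : Measurable F :=
    ((Complex.measurable_ofReal.comp (monotone_tail G t).measurable).const_mul _).const_add _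
  have hF1 : ∀ u, ‖F u‖ ≤ 1 := by
    intro u
    have h0 : 0 ≤ g u := measureReal_nonneg
    have h1 : g u ≤ 1 := measureReal_le_one
    -- `F u` is a convex combination of `1` and `z`, hence stays in the unit disc.
    have : F u = ((1 - g u : ℝ) : ℂ) + (g u : ℂ) * z := by simp only [hF]; push_cast; ring
    rw [this]
    refine (norm_add_le _ _).trans ?_
    rw [norm_mul, Complex.norm_real, Complex.norm_real, Real.norm_of_nonneg h0,
      Real.norm_of_nonneg (by linarith)]
    nlinarith
  have hFl : ∀ u, ContinuousWithinAt F (Set.Iic u) u := fun u =>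
    continuousWithinAt_const.add (continuousWithinAt_const.mul
      (Complex.continuous_ofReal.continuousAt.comp_continuousWithinAt
        (continuousWithinAt_tail G t u)))
  have hmap := (indepFun_iff_map_prod_eq_prod_map_map hA.aemeasurable hS).1
    hQ.indep_arrivals_service
  calc ∫ ω, z ^ presentCount t T ((fun j => A j ω), (fun j => S j ω)) ∂P
      = ∫ p, z ^ presentCount t T p
          ∂(P.map fun ω => ((fun j => A j ω), (fun j => S j ω))) :=
        (integral_map hQ.aemeasurable_data hz'.aestronglyMeasurable).symm
    _ = ∫ a, ∫ σ, z ^ presentCount t T (a, σ) ∂(P.map fun ω j => S j ω)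
          ∂(P.map fun ω j => A j ω) := by
        rw [hmap, integral_prod]
        refine Integrable.of_bound hz'.aestronglyMeasurable 1 (ae_of_all _ fun p => ?_)
        rw [norm_pow]
        exact pow_le_one₀ (norm_nonneg _) hz
    _ = ∫ a, ∏ j ∈ Finset.range (arrivalCount (fun j a => a j) T a), F (a j).toReal
          ∂(P.map fun ω j => A j ω) := by
        refine integral_congr_ae (ae_of_all _ fun a => ?_)
        change ∫ σ, z ^ presentCount t T (a, σ) ∂(P.map fun ω j => S j ω) = _
        refine (integral_map (f := fun σ => z ^ presentCount t T (a, σ)) hS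
          (hz'.comp measurable_prodMk_left).aestronglyMeasurable).trans ?_
        simp only [presentCount_apply]
        exact hQ.integral_pow_service t z _ fun j => (a j).toReal
    _ = ∫ ω, ∏ j ∈ Finset.range (arrivalCount A T ω), F (A j ω).toReal ∂P :=
        integral_map hA.aemeasurable
          (measurable_prod_range (measurable_arrivalCount_apply T) fun j =>
            hFmeas.comp (measurable_ereal_toReal.comp
              (measurable_pi_apply j))).aestronglyMeasurable
    _ = Complex.exp (∫ u in (0 : ℝ)..T, (F u - 1) * lam u) :=
        hQ.arrivals.integral_prod hlam_nonneg hlam_int hFmeas hF1 hFl hT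
    _ = _ := by
        rw [← intervalIntegral.integral_ofReal, ← intervalIntegral.integral_mul_const]
        congr 1
        refine intervalIntegral.integral_congr fun u _ => ?_
        simp only [hF, hg]
        push_cast
        ring

theorem IsMtGInfQueue.hasLaw_presentCount [IsProbabilityMeasure P]
    [IsProbabilityMeasure G] (hQ : IsMtGInfQueue A S S₀ lam G P)
    (hlam_nonneg : ∀ u, 0 ≤ u → 0 ≤ lam u) (hlam_int : LocallyIntegrableOn lam (Set.Ici 0))
    (t : ℝ) {T : ℝ} (hT : 0 ≤ T) :
    HasLaw (fun ω => presentCount t T ((fun j => A j ω), (fun j => S j ω)))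
      (poissonMeasure (∫ u in (0 : ℝ)..T, lam u * G.real (Set.Ioi (t - u))).toNNReal) P := by
  have hX : AEMeasurable (fun ω => presentCount t T ((fun j => A j ω), (fun j => S j ω))) P :=
    (measurable_presentCount t T).comp_aemeasurable hQ.aemeasurable_data
  refine ⟨hX, ?_⟩
  have := Measure.isProbabilityMeasure_map hX
  have hcast : Measurable (Nat.cast : ℕ → ℝ) := measurable_from_top
  have : IsProbabilityMeasure ((P.map fun ω =>
      presentCount t T ((fun j => A j ω), (fun j => S j ω))).map (Nat.cast : ℕ → ℝ)) :=
    Measure.isProbabilityMeasure_map hcast.aemeasurable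
  -- Laws on `ℕ` are compared after embedding in `ℝ`, where characteristic functions determine them;
  -- these are generating functions at $z=e^{i\xi}$.
  apply (MeasurableEmbedding.natCast (α := ℝ)).map_injective
  apply Measure.ext_of_charFun
  ext ξ
  have hz : ‖Complex.exp (ξ * Complex.I)‖ ≤ 1 := (Complex.norm_exp_ofReal_mul_I ξ).le
  rw [charFun_map_cast_poissonMeasure, charFun_apply_real,
    integral_map hcast.aemeasurable (by fun_prop), integral_map hX (by fun_prop)]
  have h := hQ.integral_pow_presentCount hlam_nonneg hlam_int t hT hz
  rw [show (((∫ u in (0 : ℝ)..T, lam u * G.real (Set.Ioi (t - u))).toNNReal : ℝ≥0) : ℂ) =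
      ((∫ u in (0 : ℝ)..T, lam u * G.real (Set.Ioi (t - u)) : ℝ) : ℂ) from
    congrArg Complex.ofReal (Real.coe_toNNReal _ (integral_mul_tail_nonneg hlam_nonneg t hT)),
    ← h]
  refine integral_congr_ae (ae_of_all _ fun ω => ?_)
  simp only [← Complex.exp_nat_mul]
  congr 1
  push_cast
  ring

theorem ae_nonneg_of_measure_Iio (hG : G (Set.Iio 0) = 0) : ∀ᵐ s ∂G, 0 ≤ s := by
  rw [ae_iff]
  simp only [not_le]
  exact hG

theorem ae_nonneg_of_hasLaw {X : Ω → ℝ} (hX : HasLaw X G P) (hG : G (Set.Iio 0) = 0) :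
    ∀ᵐ ω ∂P, 0 ≤ X ω :=
  (hX.ae_iff (p := fun x => 0 ≤ x) (measurableSet_setOfPred.1 measurableSet_Ici)).2
    (ae_nonneg_of_measure_Iio hG)

theorem IsMtGInfQueue.queueLength_ae_eq [IsProbabilityMeasure P]
    (hQ : IsMtGInfQueue A S S₀ lam G P)
    (hlam_int : LocallyIntegrableOn lam (Set.Ici 0)) {t : ℝ} (ht : 0 ≤ t) :
    ∀ᵐ ω ∂P, queueLength A S t ω =
      presentCount t t ((fun j => A j ω), (fun j => S j ω)) := by
  filter_upwards [hQ.arrivals.monotone, hQ.arrivals.locallyFinite, hQ.arrivals.count_zero,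
    hQ.arrivals.ae_ne hlam_int ht] with ω hm hf h0 hne
  rw [presentCount_apply]
  refine Finset.sum_congr rfl fun j hj => ?_
  have hle := (lt_arrivalCount_iff hm hf t j).1 (Finset.mem_range.1 hj)
  have hlt : A j ω < t := lt_of_le_of_ne hle (hne j)
  -- Labels below the count have finite arrival times, so the default value of `toReal` at `⊤` never
  -- enters.
  have hc : ((A j ω).toReal : EReal) = A j ω :=
    EReal.coe_toReal (ne_top_of_lt hlt) (ne_bot_of_gt (arrival_pos hm hf h0 j))
  have hiff : (t : EReal) < A j ω + (S j ω : EReal) ↔ t < (A j ω).toReal + S j ω := by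
    rw [← EReal.coe_lt_coe_iff, EReal.coe_add, hc]
  by_cases h : t < (A j ω).toReal + S j ω
  · rw [Set.indicator_of_mem (by exact ⟨hlt, hiff.2 h⟩)]
    simp [h]
  · rw [Set.indicator_of_notMem (by exact fun h' => h (hiff.1 h'.2))]
    simp [h]

theorem IsMtGInfQueue.overlapCount_ae_eq [IsProbabilityMeasure P]
    (hQ : IsMtGInfQueue A S S₀ lam G P)
    (hlam_int : LocallyIntegrableOn lam (Set.Ici 0)) (hG : G (Set.Iio 0) = 0)
    {t : ℝ} (ht : 0 ≤ t) :
    ∀ᵐ ω ∂P, overlapCount A S S₀ t ω =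
      presentCount t (t + S₀ ω) ((fun j => A j ω), (fun j => S j ω)) := by
  filter_upwards [hQ.arrivals.monotone, hQ.arrivals.locallyFinite, hQ.arrivals.count_zero,
    hQ.queueLength_ae_eq hlam_int ht, ae_all_iff.2 fun j =>
      ae_nonneg_of_hasLaw (hQ.service_law j) hG, ae_nonneg_of_hasLaw hQ.tagged_law hG]
    with ω hm hf h0 hq hS hS₀
  have hle : arrivalCount A t ω ≤ arrivalCount A (t + S₀ ω) ω :=
    arrivalCount_mono hf (by linarith)
  have hone : ∀ j ∈ Finset.Ico (arrivalCount A t ω) (arrivalCount A (t + S₀ ω) ω),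
      (if t < (A j ω).toReal + S j ω then 1 else 0) = 1 := by
    intro j hj
    rw [Finset.mem_Ico] at hj
    have h2 := (lt_arrivalCount_iff hm hf _ j).1 hj.2
    have h1 : (t : EReal) < A j ω := by
      by_contra h
      exact absurd ((lt_arrivalCount_iff hm hf _ j).2 (not_lt.1 h)) (not_lt.2 hj.1)
    have hc : ((A j ω).toReal : EReal) = A j ω :=
      EReal.coe_toReal (ne_top_of_le_ne_top (EReal.coe_ne_top _) h2) (ne_bot_of_gt h1)
    rw [← hc, EReal.coe_lt_coe_iff] at h1
    rw [if_pos (by linarith [hS j])]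
  calc overlapCount A S S₀ t ω
      = (∑ j ∈ Finset.range (arrivalCount A t ω),
          if t < (A j ω).toReal + S j ω then 1 else 0) +
        ∑ j ∈ Finset.Ico (arrivalCount A t ω) (arrivalCount A (t + S₀ ω) ω),
          if t < (A j ω).toReal + S j ω then 1 else 0 := by
        rw [Finset.sum_congr rfl hone, Finset.sum_const, Nat.card_Ico, smul_eq_mul, mul_one,
          overlapCount, hq, add_comm, presentCount_apply]
        rfl
    _ = ∑ j ∈ Finset.range (arrivalCount A (t + S₀ ω) ω),
          if t < (A j ω).toReal + S j ω then 1 else 0 := Finset.sum_range_add_sum_Ico _ hle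
    _ = _ := (presentCount_apply _ _ _ _).symm

/-- `cumRate` is monotone on $[0,\infty)$, which carries `G`; nothing is known of the rate at
negative times, so only almost-everywhere measurability is claimed. -/
theorem aemeasurable_cumRate_add (hlam_nonneg : ∀ u, 0 ≤ u → 0 ≤ lam u)
    (hlam_int : LocallyIntegrableOn lam (Set.Ici 0)) (hG : G (Set.Iio 0) = 0)
    {t : ℝ} (ht : 0 ≤ t) (c : ℝ) : AEMeasurable (fun s => cumRate lam t s + c) G := by
  have hmono : MonotoneOn (fun s => cumRate lam t s + c) (Set.Ici 0) := by
    intro a ha b hb hab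
    have ha' : (0 : ℝ) ≤ a := ha
    refine add_le_add_left ?_ c
    refine intervalIntegral.integral_mono_interval le_rfl (by linarith) (by linarith) ?_
      (intervalIntegrable_of_locallyIntegrableOn_Ici hlam_int ht (by linarith))
    filter_upwards [ae_restrict_mem measurableSet_Ioc] with u hu
    exact hlam_nonneg u (ht.trans hu.1.le)
  have h := aemeasurable_restrict_of_monotoneOn (μ := G) measurableSet_Ici hmono
  rwa [Measure.restrict_eq_self_of_ae_mem] at h
  exact ae_nonneg_of_measure_Iio hG

theorem IsMtGInfQueue.mixedPoisson_apply (hQ : IsMtGInfQueue A S S₀ lam G P)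
    (hlam_nonneg : ∀ u, 0 ≤ u → 0 ≤ lam u) (hlam_int : LocallyIntegrableOn lam (Set.Ici 0))
    (hG : G (Set.Iio 0) = 0) {t : ℝ} (ht : 0 ≤ t) (c : ℝ) (B : Set ℕ) :
    mixedPoisson (fun ω => cumRate lam t (S₀ ω) + c) P B =
      ∫⁻ s, poissonMeasure (cumRate lam t s + c).toNNReal B ∂G := by
  have hM := (aemeasurable_cumRate_add hlam_nonneg hlam_int hG ht c).real_toNNReal
  have hB : Measurable fun r : ℝ≥0 => poissonMeasure r B :=
    (Measure.measurable_coe (Set.to_countable B).measurableSet).comp measurable_poissonMeasure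
  have hM' : AEMeasurable (fun ω => (cumRate lam t (S₀ ω) + c).toNNReal) P :=
    AEMeasurable.comp_aemeasurable (g := fun s => (cumRate lam t s + c).toNNReal)
      (by rw [hQ.tagged_law.map_eq]; exact hM) hQ.tagged_law.aemeasurable
  rw [mixedPoisson, Measure.bind_apply (Set.to_countable B).measurableSet
    measurable_poissonMeasure.aemeasurable, lintegral_map' hB.aemeasurable hM']
  exact hQ.tagged_law.lintegral_comp
    (f := fun s => poissonMeasure (cumRate lam t s + c).toNNReal B) (hB.comp_aemeasurable hM)

theorem IsMtGInfQueue.hasLaw_overlapCount [IsProbabilityMeasure P]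
    [IsProbabilityMeasure G] (hQ : IsMtGInfQueue A S S₀ lam G P)
    (hlam_nonneg : ∀ u, 0 ≤ u → 0 ≤ lam u) (hlam_int : LocallyIntegrableOn lam (Set.Ici 0))
    (hG : G (Set.Iio 0) = 0) {t : ℝ} (ht : 0 ≤ t) :
    HasLaw (overlapCount A S S₀ t)
      (mixedPoisson (fun ω => cumRate lam t (S₀ ω) + meanQueue lam G t) P) P := by
  refine HasLaw.congr ?_ (hQ.overlapCount_ae_eq hlam_int hG ht)
  set D : Ω → (ℕ → EReal) × (ℕ → ℝ) := fun ω => ((fun j => A j ω), (fun j => S j ω)) with hD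
  have hDm : AEMeasurable D P := hQ.aemeasurable_data
  have hS₀ := hQ.tagged_law.aemeasurable
  have := Measure.isProbabilityMeasure_map hDm
  set f : ((ℕ → EReal) × (ℕ → ℝ)) × ℝ → ℕ := fun q => presentCount t (t + q.2) q.1 with hf
  have hfm : Measurable f := measurable_presentCount_uncurry t (measurable_id.const_add t)
  have hmap := (indepFun_iff_map_prod_eq_prod_map_map hDm hS₀).1 hQ.indep_tagged
  rw [hQ.tagged_law.map_eq] at hmap
  refine ⟨hfm.comp_aemeasurable (hDm.prodMk hS₀), ?_⟩
  ext B hB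
  rw [hQ.mixedPoisson_apply hlam_nonneg hlam_int hG ht]
  change P.map (f ∘ fun ω => (D ω, S₀ ω)) B = _
  rw [← AEMeasurable.map_map_of_aemeasurable hfm.aemeasurable (hDm.prodMk hS₀), hmap,
    -- The joint law is a product, so integrating over `S₀` last amounts to conditioning on
    -- $\mathcal S=s$; each slice is a thinned count up to the deterministic time $t+s$.
    Measure.map_apply hfm hB, Measure.prod_apply_symm (hfm hB)]
  refine lintegral_congr_ae ?_
  filter_upwards [ae_nonneg_of_measure_Iio hG] with s hs
  have hlaw := hQ.hasLaw_presentCount hlam_nonneg hlam_int t (add_nonneg ht hs)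
  rw [integral_mul_tail_eq hlam_int hG ht hs] at hlaw
  rw [← hlaw.map_eq, Measure.map_apply_of_aemeasurable hlaw.aemeasurable hB,
    ← Set.preimage_comp,
    Measure.map_apply_of_aemeasurable hDm ((hfm.comp measurable_prodMk_right) hB)]
  rfl

end Queue
end InfiniteServer

/-! ### The mixture, its point probabilities and the mean queue length -/

theorem mainTheorem3 {Ω : Type*} {mΩ : MeasurableSpace Ω} (P : Measure Ω) [IsProbabilityMeasure P]
    (lam : ℝ → ℝ) (hlam_nonneg : ∀ u, 0 ≤ u → 0 ≤ lam u)
    (hlam_int : LocallyIntegrableOn lam (Set.Ici 0))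
    (G : Measure ℝ) [IsProbabilityMeasure G] (hG : G (Set.Iio 0) = 0)
    (A : ℕ → Ω → EReal) (S : ℕ → Ω → ℝ) (S₀ : Ω → ℝ)
    (hQ : InfiniteServer.IsMtGInfQueue A S S₀ lam G P) (t : ℝ) (ht : 0 ≤ t) :
    HasLaw (InfiniteServer.overlapCount A S S₀ t)
        (InfiniteServer.mixedPoisson
          (fun ω => (∫ s in t..(t + S₀ ω), lam s)
            + ∫ u in (0 : ℝ)..t, lam u * G.real (Set.Ioi (t - u))) P) P ∧
      (∀ k : ℕ, P.real {ω | InfiniteServer.overlapCount A S S₀ t ω = k} =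
        ∫ s in Set.Ici (0 : ℝ),
          Real.exp (-(InfiniteServer.cumRate lam t s + InfiniteServer.meanQueue lam G t)) *
            (InfiniteServer.cumRate lam t s + InfiniteServer.meanQueue lam G t) ^ k / (k ! : ℝ)
          ∂G) ∧
      Integrable (fun ω => (InfiniteServer.queueLength A S t ω : ℝ)) P ∧
      ∫ ω, (InfiniteServer.queueLength A S t ω : ℝ) ∂P = InfiniteServer.meanQueue lam G t := by
  have hlaw := hQ.hasLaw_overlapCount hlam_nonneg hlam_int hG ht
  have hlawQ := (hQ.hasLaw_presentCount hlam_nonneg hlam_int t ht).congr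
    (hQ.queueLength_ae_eq hlam_int ht)
  have hq : 0 ≤ InfiniteServer.meanQueue lam G t :=
    InfiniteServer.integral_mul_tail_nonneg hlam_nonneg t ht
  refine ⟨hlaw, fun k => ?_, ?_, ?_⟩
  · have hmem : ∀ᵐ s ∂G, s ∈ Set.Ici (0 : ℝ) := InfiniteServer.ae_nonneg_of_measure_Iio hG
    have hM := InfiniteServer.aemeasurable_cumRate_add hlam_nonneg hlam_int hG ht
      (InfiniteServer.meanQueue lam G t)
    rw [hlaw.measureReal_eq (p := fun n => n = k) (Set.to_countable _).measurableSet,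
      measureReal_def, hQ.mixedPoisson_apply hlam_nonneg hlam_int hG ht,
      Measure.restrict_eq_self_of_ae_mem hmem]
    -- Nonnegativity of the mean removes the truncation `toNNReal` in the mixed Poisson law.
    have hnn : ∀ᵐ s ∂G, 0 ≤ InfiniteServer.cumRate lam t s + InfiniteServer.meanQueue lam G t := by
      filter_upwards [hmem] with s hs
      have hs' : (0 : ℝ) ≤ s := hs
      exact add_nonneg (intervalIntegral.integral_nonneg (by linarith)
        fun u hu => hlam_nonneg u (ht.trans hu.1)) hq
    rw [integral_eq_lintegral_of_nonneg_ae]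
    · congr 1
      refine lintegral_congr_ae ?_
      filter_upwards [hnn] with s hs
      have := poissonMeasure_singleton
        (InfiniteServer.cumRate lam t s + InfiniteServer.meanQueue lam G t).toNNReal k
      rw [Real.coe_toNNReal _ hs] at this
      exact this
    · filter_upwards [hnn] with s hs
      simp only [Pi.zero_apply]
      positivity
    · exact (((Real.measurable_exp.comp_aemeasurable hM.neg).mul
        (hM.pow_const k)).div_const _).aestronglyMeasurable
  · exact (hlawQ.map_eq ▸ InfiniteServer.integrable_natCast_poissonMeasure _ :
      Integrable (fun n : ℕ => (n : ℝ))
      (P.map (InfiniteServer.queueLength A S t))).comp_aemeasurable hlawQ.aemeasurable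
  · have := hlawQ.integral_comp (f := fun n : ℕ => (n : ℝ))
      measurable_from_top.aestronglyMeasurable
    simp only [Function.comp_def] at this
    rw [this, InfiniteServer.integral_natCast_poissonMeasure]
    exact Real.coe_toNNReal _ hq
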